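/- Let $S=\mathsf k[x_1,\dots,x_n]$ be a polynomial ring over a field $\mathsf k$, let $I\subseteq S$ be a square-free monomial ideal (an ideal generated by square-free monomials), and let $m_1,\dots,m_q$ be the minimal monomial generators of $I$, listed in any order. Let $\mathbb{L}^2_q$ be the simplicial complex on the vertices $\ell_{i,j}$, $1\le i\le j\le q$ (with the convention $\ell_{j,i}=\ell_{i,j}$), whose faces are all subsets of the sets $\{\ell_{i,j} : 1\le j\le q\}$ for $1\le i\le q$ and of the set $\{\ell_{i,j} : 1\le i<j\le q\}$. Label the vertex $\ell_{i,j}$ with the monomial $m_im_j$. Let $\mathbb{L}^2(I)$ be the induced subcomplex of $\mathbb{L}^2_q$ obtained by deleting vertices as follows: for all $i,j,u,v\in\{1,\dots,q\}$ with $\{i,j\}\neq\{u,v\}$ and $m_im_j\mid m_um_v$, - if $m_im_j=m_um_v$ and $i=\min\{i,j,u,v\}$, then $\ell_{i,j}$ is deleted; - if $m_im_j\neq m_um_v$, then $\ell_{u,v}$ is deleted. Then $\mathbb{L}^2(I)$ supports a free resolution of $I^2$. That is, the labels of the vertices of $\mathbb{L}^2(I)$ are the minimal monomial generators of $I^2$,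 each occurring exactly once, and the sequence $$\cdots\to C_2\xrightarrow{\partial}C_1\xrightarrow{\partial}C_0\xrightarrow{\varepsilon}I^2\to 0$$ is exact. Here $C_d$ is the free $S$-module on the $d$-dimensional faces $\sigma$ of $\mathbb{L}^2(I)$. The label $m_\sigma$ of a face $\sigma$ is the least common multiple of the labels of its vertices. The maps are given by $\varepsilon(v)=m_v$ for a vertex $v$, and $$\partial(\sigma)=\sum_{v\in\sigma}(-1)^{|\{w\in\sigma\,:\,w<v\}|}\,\frac{m_\sigma}{m_{\sigma\setminus\{v\}}}\;(\sigma\setminus\{v\}),$$ where the vertices are ordered lexicographically by their indices $(i,j)$, $i\le j$. -/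

import Mathlib

noncomputable section

namespace MonomialResolution

/-! ### Monomial ideals

A monomial `x₁^{a₁} ⋯ xₙ^{aₙ}` is given by its exponent vector `a : Fin n →₀ ℕ`.  Under this
encoding the product of monomials is `a + b`, divisibility is `a ≤ b`, and the least common
multiple is `a ⊔ b`. -/

variable {n : ℕ}

/-- The monomial with exponent vector `a`, as an element of `k[x₁, …, xₙ]`. -/
def mono (k : Type*) [Field k] (a : Fin n →₀ ℕ) : MvPolynomial (Fin n) k :=
  MvPolynomial.monomial a 1

/-- A monomial is square-free if no variable occurs in it with exponent larger than one. -/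
def IsSquareFreeMonomial (a : Fin n →₀ ℕ) : Prop := ∀ x, a x ≤ 1

/-- A square-free monomial ideal is an ideal that is generated by square-free monomials. -/
def IsSquareFreeMonomialIdeal {k : Type*} [Field k] (I : Ideal (MvPolynomial (Fin n) k)) : Prop :=
  ∃ A : Set (Fin n →₀ ℕ), (∀ a ∈ A, IsSquareFreeMonomial a) ∧ I = Ideal.span (mono k '' A)

/-- The ideal `I` is minimally generated by the monomials `m i`: they generate `I`, and none of
them lies in the ideal generated by the others (in particular the `m i` are distinct). -/
structure IsMinimallyGeneratedBy {k : Type*} [Field k] {ι : Type*}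
    (I : Ideal (MvPolynomial (Fin n) k)) (m : ι → (Fin n →₀ ℕ)) : Prop where
  span_eq : Ideal.span (Set.range fun i => mono k (m i)) = I
  irredundant : ∀ i, mono k (m i) ∉ Ideal.span ((fun j => mono k (m j)) '' {j | j ≠ i})

/-! ### Simplicial complexes -/

section Complexes

variable {V : Type*}

/-- The simplicial complex `⟨F₁, F₂, …⟩`, whose faces are the subsets of the given sets.
(In Mathlib's convention the empty face is left out.) -/
def generatedBy (S : Set (Finset V)) : PreAbstractSimplicialComplex V where
  faces := {σ | σ.Nonempty ∧ ∃ F ∈ S, σ ⊆ F}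
  isRelLowerSet_faces := fun _ hσ =>
    ⟨hσ.1, fun _ hτ hne => ⟨hne, hσ.2.imp fun _ hF => ⟨hF.1, hτ.trans hF.2⟩⟩⟩

/-- The induced subcomplex `{σ ∈ Δ | σ ⊆ W}`. -/
def induced (Δ : PreAbstractSimplicialComplex V) (W : Set V) : PreAbstractSimplicialComplex V where
  faces := {σ | σ ∈ Δ.faces ∧ ∀ v ∈ σ, v ∈ W}
  isRelLowerSet_faces := fun _ hσ =>
    ⟨(Δ.isRelLowerSet_faces hσ.1).1, fun _ hτ hne =>
      ⟨(Δ.isRelLowerSet_faces hσ.1).2 hτ hne, fun v hv => hσ.2 v (hτ hv)⟩⟩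

/-- The vertices of `Δ`. -/
def Vertex (Δ : PreAbstractSimplicialComplex V) : Type _ := {v : V // {v} ∈ Δ.faces}

/-- The faces of `Δ` of dimension `d`. -/
def Face (Δ : PreAbstractSimplicialComplex V) (d : ℕ) : Type _ :=
  {σ : Finset V // σ ∈ Δ.faces ∧ σ.card = d + 1}

/-! ### The homogenized simplicial chain complex of a labeled simplicial complex -/

/-- The label of a face: the least common multiple of the labels of its vertices. -/
def faceLabel (label : V → (Fin n →₀ ℕ)) (σ : Finset V) : Fin n →₀ ℕ := σ.sup label

/-- The free `k[x₁, …, xₙ]`-module with basis the `d`-dimensional faces of `Δ`. -/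
abbrev Chain (k : Type*) [Field k] (n : ℕ) (Δ : PreAbstractSimplicialComplex V) (d : ℕ) : Type _ :=
  Face Δ d →₀ MvPolynomial (Fin n) k

/-- The augmentation, which sends each vertex to its label. -/
def augmentation (k : Type*) [Field k] (Δ : PreAbstractSimplicialComplex V)
    (label : V → (Fin n →₀ ℕ)) :
    Chain k n Δ 0 →ₗ[MvPolynomial (Fin n) k] MvPolynomial (Fin n) k :=
  Finsupp.linearCombination (MvPolynomial (Fin n) k) fun σ : Face Δ 0 =>
    mono k (faceLabel label σ.1)

variable [LinearOrder V]

/-- The `d`-dimensional face `σ ∖ {v}` of a `(d+1)`-dimensional face `σ`. -/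
def Face.delete {Δ : PreAbstractSimplicialComplex V} {d : ℕ} (σ : Face Δ (d + 1))
    (v : V) (hv : v ∈ σ.1) : Face Δ d :=
  ⟨σ.1.erase v, by
    have hcard : (σ.1.erase v).card = d + 1 := by
      rw [Finset.card_erase_of_mem hv, σ.2.2, Nat.add_sub_cancel]
    exact ⟨(Δ.isRelLowerSet_faces σ.2.1).2 (Finset.erase_subset v σ.1)
      (Finset.card_pos.1 (by omega)), hcard⟩⟩

/-- The coefficient `± lcm(σ) / lcm(σ ∖ {v})` of the face `σ ∖ {v}` in the boundary of `σ`.  The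
sign is `(-1)^p`, where `p` is the position (counted from zero) of `v` among the vertices of `σ`. -/
def boundaryCoeff (k : Type*) [Field k] (label : V → (Fin n →₀ ℕ)) (σ : Finset V) (v : V) :
    MvPolynomial (Fin n) k :=
  (-1) ^ (σ.filter (· < v)).card * mono k (faceLabel label σ - faceLabel label (σ.erase v))

/-- The homogenized simplicial boundary map, from chains of dimension `d + 1` to chains of
dimension `d`; it sends `σ` to `∑_{v ∈ σ} ± lcm(σ) / lcm(σ ∖ {v}) • (σ ∖ {v})`. -/
def boundary (k : Type*) [Field k] (Δ : PreAbstractSimplicialComplex V)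
    (label : V → (Fin n →₀ ℕ)) (d : ℕ) :
    Chain k n Δ (d + 1) →ₗ[MvPolynomial (Fin n) k] Chain k n Δ d :=
  Finsupp.linearCombination (MvPolynomial (Fin n) k) fun σ : Face Δ (d + 1) =>
    ∑ v : {v // v ∈ σ.1}, Finsupp.single (σ.delete v.1 v.2) (boundaryCoeff k label σ.1 v.1)

/-- The simplicial complex `Δ`, with vertex `v` labeled by the monomial `label v`, supports a free
resolution of `I`: the vertices are labeled by the minimal monomial generators of `I` (each
occurring once), and the homogenized simplicial chain complex is a free resolution of `I`, that is,
the sequence `⋯ → C₂ → C₁ → C₀ → I → 0` is exact. -/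
structure SupportsFreeResolution {k : Type*} [Field k] (Δ : PreAbstractSimplicialComplex V)
    (label : V → (Fin n →₀ ℕ)) (I : Ideal (MvPolynomial (Fin n) k)) : Prop where
  minimallyGenerated : IsMinimallyGeneratedBy I fun v : Vertex Δ => label v.1
  range_augmentation : LinearMap.range (augmentation k Δ label) = I
  exact_zero : Function.Exact (boundary k Δ label 0) (augmentation k Δ label)
  exact_succ : ∀ d, Function.Exact (boundary k Δ label (d + 1)) (boundary k Δ label d)

end Complexes

/-! ### The complexes `𝕃²_q` and `𝕃²(I)` -/

/-- The vertex set `{ℓ_{i,j} | i ≤ j}` of `𝕃²_q`, ordered lexicographically. -/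
abbrev LVertex (q : ℕ) : Type :=
  {p : Fin q ×ₗ Fin q // (ofLex p).1 ≤ (ofLex p).2}

/-- The vertex `ℓ_{i,j}`, with the convention `ℓ_{j,i} = ℓ_{i,j}`. -/
def ell {q : ℕ} (i j : Fin q) : LVertex q := ⟨toLex (min i j, max i j), min_le_max⟩

/-- The complex `𝕃²_q`, generated by the sets `{ℓ_{i,j} | 1 ≤ j ≤ q}` for `1 ≤ i ≤ q`, and the set
`{ℓ_{i,j} | 1 ≤ i < j ≤ q}`. -/
def L2q (q : ℕ) : PreAbstractSimplicialComplex (LVertex q) :=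
  generatedBy
    (Set.range (fun i : Fin q => Finset.univ.image fun j => ell i j) ∪
      {(Finset.univ.filter fun p : Fin q × Fin q => p.1 < p.2).image fun p => ell p.1 p.2})

/-- The label `m_i m_j` of the vertex `ℓ_{i,j}`. -/
def L2label {q : ℕ} (m : Fin q → (Fin n →₀ ℕ)) (v : LVertex q) : Fin n →₀ ℕ :=
  m (ofLex v.1).1 + m (ofLex v.1).2

/-- The set of deleted vertices: whenever `{i, j} ≠ {u, v}` and `m_i m_j ∣ m_u m_v`,
* if `m_i m_j = m_u m_v` and `i = min {i, j, u, v}`, then `ℓ_{i,j}` is deleted;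
* if `m_i m_j ≠ m_u m_v`, then `ℓ_{u,v}` is deleted. -/
def deletedVertices {q : ℕ} (m : Fin q → (Fin n →₀ ℕ)) : Set (LVertex q) :=
  {x | ∃ i j u v : Fin q, ({i, j} : Set (Fin q)) ≠ {u, v} ∧ m i + m j ≤ m u + m v ∧
    ((m i + m j = m u + m v ∧ (i ≤ j ∧ i ≤ u ∧ i ≤ v) ∧ x = ell i j) ∨
      (m i + m j ≠ m u + m v ∧ x = ell u v))}

/-- The complex `𝕃²(I)` of the ideal `I` minimally generated by `m_1, …, m_q`: the subcomplex of
`𝕃²_q` induced on the vertices that are not deleted. -/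
def L2 {q : ℕ} (m : Fin q → (Fin n →₀ ℕ)) : PreAbstractSimplicialComplex (LVertex q) :=
  induced (L2q q) (deletedVertices m)ᶜ

end MonomialResolution

end

/-! Multiplying the coefficient of each face by the label of that face turns the homogenized complex
into ordinary simplicial chains with polynomial coefficients. These split by multidegree `b`, so
exactness follows once the subcomplex of faces whose label divides `b` has no reduced homology over
`k` (`exists_simplexBoundary_eq`).

For 𝕃²(I), the surviving vertices `ell i j` with `i ≠ j` below `b` span a full simplex. A surviving
square `ell i i` below `b` meets the rest in the face of that simplex formed by the surviving `ell i
j`, `j ≠ i`: it is a cone over that face. Attaching cones over nonempty faces of a nonempty simplex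
creates no homology (`isAcyclicFamily_of_cones`).

Square-freeness enters in showing that these faces are nonempty
(`exists_ell_notMem_deletedVertices`). If `ell i i` is not the only vertex below `b`, then some `m i
+ m j ≤ b` with `j ≠ i`, and choosing `j` with the degree of `m j - m i` minimal makes `ell i j`
survive. Minimal generation of I² is separate: deletion keeps exactly one vertex for each minimal
label. -/

namespace MonomialResolution

/-! ### Chains of the full simplex and acyclicity of attached cones -/

section Simplex

variable {V : Type*} [LinearOrder V] {M N : Type*} [AddCommGroup M] [AddCommGroup N]

/-- The sign of the position of `v` in `σ ∪ {v}`. -/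
def posSign (σ : Finset V) (v : V) : ℤ := (-1) ^ (σ.filter (· < v)).card

theorem posSign_mul_self (σ : Finset V) (v : V) : posSign σ v * posSign σ v = 1 := by
  unfold posSign
  rw [← mul_pow]
  simp

theorem posSign_erase_self (σ : Finset V) (v : V) : posSign (σ.erase v) v = posSign σ v := by
  unfold posSign
  congr 2
  ext w
  simp only [Finset.mem_filter, Finset.mem_erase]
  constructor
  · rintro ⟨⟨_, h⟩, h'⟩; exact ⟨h, h'⟩
  · rintro ⟨h, h'⟩; exact ⟨⟨h'.ne, h⟩, h'⟩

theorem posSign_insert_of_lt {σ : Finset V} {u v : V} (hu : u ∉ σ) (h : u < v) :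
    posSign (insert u σ) v = -posSign σ v := by
  unfold posSign
  rw [Finset.filter_insert, if_pos h, Finset.card_insert_of_notMem (by simp [hu]), pow_succ]
  ring

theorem posSign_insert_of_le {σ : Finset V} {u v : V} (h : v ≤ u) :
    posSign (insert u σ) v = posSign σ v := by
  unfold posSign
  rw [Finset.filter_insert, if_neg h.not_gt]

/-- Of two new vertices, only the smaller one shifts the position of the other. This sign change is
what makes the boundary square to zero. -/
theorem posSign_insert_mul {σ : Finset V} {u v : V} (hu : u ∉ σ) (hv : v ∉ σ) (h : u ≠ v) :
    posSign σ u * posSign (insert u σ) v = -(posSign σ v * posSign (insert v σ) u) := by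
  rcases lt_or_gt_of_ne h with h | h
  · rw [posSign_insert_of_lt hu h, posSign_insert_of_le h.le]; ring
  · rw [posSign_insert_of_le h.le, posSign_insert_of_lt hv h]; ring

/-- The join with the vertex `g`, as an operator on simplicial chains. -/
def cone (g : V) (f : Finset V → M) (σ : Finset V) : M :=
  if g ∈ σ then posSign σ g • f (σ.erase g) else 0

theorem cone_ne_zero {g : V} {f : Finset V → M} {σ : Finset V} (h : cone g f σ ≠ 0) :
    ∃ τ, g ∉ τ ∧ σ = insert g τ ∧ f τ ≠ 0 := by
  unfold cone at h
  split_ifs at h with hg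
  · exact ⟨σ.erase g, Finset.notMem_erase g σ, (Finset.insert_erase hg).symm,
      fun h0 => h (by rw [h0, smul_zero])⟩
  · exact absurd rfl h

variable [Fintype V]

/-- The simplicial boundary on the chains of the full simplex on `V`, the empty face included. A
chain is given by its coefficient function. -/
def simplexBoundary : (Finset V → M) →+ (Finset V → M) where
  toFun f τ := ∑ v, if v ∈ τ then 0 else posSign τ v • f (insert v τ)
  map_zero' := by ext; simp
  map_add' f g := by
    ext τ
    simp only [Pi.add_apply, ← Finset.sum_add_distrib]
    refine Finset.sum_congr rfl fun v _ => ?_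
    split_ifs <;> simp

theorem simplexBoundary_apply (f : Finset V → M) (τ : Finset V) :
    simplexBoundary f τ = ∑ v, if v ∈ τ then 0 else posSign τ v • f (insert v τ) := rfl

theorem simplexBoundary_comp (φ : M →+ N) (f : Finset V → M) (τ : Finset V) :
    simplexBoundary (fun σ => φ (f σ)) τ = φ (simplexBoundary f τ) := by
  simp only [simplexBoundary_apply, map_sum]
  refine Finset.sum_congr rfl fun v _ => ?_
  split_ifs <;> simp

theorem simplexBoundary_simplexBoundary (f : Finset V → M) :
    simplexBoundary (simplexBoundary f) = 0 := by
  ext τ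
  have key : simplexBoundary (simplexBoundary f) τ = ∑ p : V × V,
      if p.1 ∉ τ ∧ p.2 ∉ τ ∧ p.1 ≠ p.2 then
        (posSign τ p.1 * posSign (insert p.1 τ) p.2) • f (insert p.2 (insert p.1 τ)) else 0 := by
    rw [simplexBoundary_apply, Fintype.sum_prod_type]
    refine Finset.sum_congr rfl fun u _ => ?_
    by_cases hu : u ∈ τ
    · simp [hu]
    rw [if_neg hu, simplexBoundary_apply, Finset.smul_sum]
    refine Finset.sum_congr rfl fun v _ => ?_
    by_cases hv : v ∈ τ
    · simp [hv]
    by_cases huv : u = v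
    · simp [huv]
    · simp [hu, hv, huv, Ne.symm huv, mul_smul]
  rw [key]
  -- Adding `u` then `v` gives the same face as adding `v` then `u`, with opposite sign, so the
  -- terms cancel in pairs.
  refine Finset.sum_involution (fun p _ => p.swap) ?_ ?_ (by simp) (by simp)
  · rintro ⟨u, v⟩ -
    by_cases h : u ∉ τ ∧ v ∉ τ ∧ u ≠ v
    · have h' : v ∉ τ ∧ u ∉ τ ∧ v ≠ u := ⟨h.2.1, h.1, h.2.2.symm⟩
      simp only [Prod.swap, if_pos h, if_pos h']
      rw [posSign_insert_mul h.1 h.2.1 h.2.2, Finset.insert_comm]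
      simp
    · have h' : ¬ (v ∉ τ ∧ u ∉ τ ∧ v ≠ u) := fun h' => h ⟨h'.2.1, h'.1, h'.2.2.symm⟩
      simp only [Prod.swap, if_neg h, if_neg h', add_zero]
  · rintro ⟨u, v⟩ - h h'
    simp only [Prod.swap, Prod.mk.injEq] at h'
    simp [h'.1] at h

/-- The contracting homotopy of the simplex. It holds for every chain, with no correction in the
lowest degree, because the empty face is included. -/
theorem simplexBoundary_cone (g : V) (f : Finset V → M) :
    simplexBoundary (cone g f) = f - cone g (simplexBoundary f) := by
  rw [eq_sub_iff_add_eq]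
  ext τ
  rw [Pi.add_apply]
  by_cases hg : g ∈ τ
  · obtain ⟨ρ, hgρ, rfl⟩ : ∃ ρ, g ∉ ρ ∧ insert g ρ = τ :=
      ⟨τ.erase g, Finset.notMem_erase g τ, Finset.insert_erase hg⟩
    rw [cone, if_pos hg, simplexBoundary_apply, simplexBoundary_apply, Finset.erase_insert hgρ,
      Finset.smul_sum, ← Finset.sum_add_distrib, Finset.sum_eq_single g]
    · simp only [hg, if_true, if_neg hgρ, zero_add]
      rw [posSign_insert_of_le le_rfl, smul_smul, posSign_mul_self, one_smul]
    · intro v _ hv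
      by_cases hvρ : v ∈ ρ
      · simp [hvρ]
      have h1 : v ∉ insert g ρ := by simp [hv, hvρ]
      rw [if_neg h1, if_neg hvρ, cone, if_pos (by simp), Finset.insert_comm,
        Finset.erase_insert (by simp [hv.symm, hgρ]), smul_smul, smul_smul,
        Finset.insert_comm, ← add_smul]
      convert zero_smul ℤ _
      rcases lt_or_gt_of_ne hv with h | h
      · rw [posSign_insert_of_lt h1 h, posSign_insert_of_le (v := v) h.le]; ring
      · rw [posSign_insert_of_le (v := g) h.le, posSign_insert_of_lt hgρ h]; ring
    · simp
  · rw [cone, if_neg hg, add_zero, simplexBoundary_apply, Finset.sum_eq_single g]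
    · rw [if_neg hg, cone, if_pos (by simp), Finset.erase_insert hg,
        posSign_insert_of_le le_rfl, smul_smul, posSign_mul_self, one_smul]
    · intro v _ hv
      split_ifs with h
      · rfl
      · rw [cone, if_neg (by simp [hv.symm, hg]), smul_zero]
    · simp

theorem simplexBoundary_ne_zero {f : Finset V → M} {τ : Finset V}
    (h : simplexBoundary f τ ≠ 0) : ∃ v, v ∉ τ ∧ f (insert v τ) ≠ 0 := by
  obtain ⟨v, -, hv⟩ := Finset.exists_ne_zero_of_sum_ne_zero h
  split_ifs at hv with h'
  · exact absurd rfl hv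
  · exact ⟨v, h', fun h0 => hv (by rw [h0, smul_zero])⟩

theorem simplexBoundary_single (σ : Finset V) (a : M) :
    simplexBoundary (Pi.single σ a) =
      ∑ v : {v // v ∈ σ}, Pi.single (σ.erase v.1) (posSign σ v.1 • a) := by
  ext τ
  rw [Finset.sum_apply, simplexBoundary_apply,
    Finset.sum_coe_sort σ fun v => (Pi.single (σ.erase v) (posSign σ v • a) : Finset V → M) τ,
    ← Finset.sum_filter_add_sum_filter_not Finset.univ (· ∈ σ)]
  rw [Finset.sum_eq_zero (s := Finset.univ.filter (¬ · ∈ σ)), add_zero,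
    Finset.filter_univ_mem]
  · refine Finset.sum_congr rfl fun v hv => ?_
    by_cases h : τ = σ.erase v
    · subst h
      simp [Finset.insert_erase hv, posSign_erase_self]
    · rw [Pi.single_eq_of_ne h]
      split_ifs with hvτ
      · rfl
      · rw [Pi.single_eq_of_ne, smul_zero]
        rintro rfl
        exact h (Finset.erase_insert hvτ).symm
  · intro v hv
    split_ifs with hvτ
    · rfl
    · rw [Pi.single_eq_of_ne, smul_zero]
      rintro rfl
      simp at hv

/-- A family of finite sets is acyclic over `M` in positive cardinalities if every nonempty cycle
supported on the family bounds. -/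
def IsAcyclicFamily (M : Type*) [AddCommGroup M] (P : Set (Finset V)) : Prop :=
  ∀ (r : ℕ) (f : Finset V → M), (∀ σ, f σ ≠ 0 → σ ∈ P ∧ σ.card = r + 1) →
    simplexBoundary f = 0 →
    ∃ y : Finset V → M, (∀ σ, y σ ≠ 0 → σ ∈ P ∧ σ.card = r + 2) ∧ simplexBoundary y = f

/-- A simplex to which cones over nonempty faces are attached is acyclic. The apexes of the cones
are the elements of `D`, and `p v` is a vertex of the face over which `v` is the cone. -/
theorem isAcyclicFamily_of_cones {P : Set (Finset V)} (hP : IsLowerSet P) (D : Finset V)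
    (hD : ∀ σ ∈ P, ∀ v ∈ D, ∀ w ∈ D, v ∈ σ → w ∈ σ → v = w) (p : V → V)
    (hp : ∀ v ∈ D, ∀ σ ∈ P, v ∈ σ → insert (p v) σ ∈ P ∧ p v ∉ D)
    (g : V) (hg : ∀ σ ∈ P, Disjoint σ D → insert g σ ∈ P) : IsAcyclicFamily M P := by
  intro r f hf hbf
  -- `f' v` is the part of the cycle on faces through the apex `v`. No face contains two apexes, so
  -- these parts do not overlap.
  let f' : V → Finset V → M := fun v σ => if v ∈ σ then f σ else 0
  have hf' : ∀ v τ, simplexBoundary (f' v) τ ≠ 0 → v ∉ τ ∧ f (insert v τ) ≠ 0 := by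
    intro v τ h
    -- At a face through `v`, the boundaries of `f' v` and of `f` have the same terms, and the
    -- latter is zero.
    have hv : v ∉ τ := by
      intro hv
      refine h ((?_ : _ = simplexBoundary f τ).trans (congrFun hbf τ))
      rw [simplexBoundary_apply, simplexBoundary_apply]
      refine Finset.sum_congr rfl fun w _ => ?_
      simp only [f', Finset.mem_insert_of_mem hv, if_true]
    refine ⟨hv, ?_⟩
    obtain ⟨w, hw, hw'⟩ := simplexBoundary_ne_zero h
    simp only [f'] at hw'
    split_ifs at hw' with h1
    · rcases Finset.mem_insert.1 h1 with rfl | h1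
      · exact hw'
      · exact absurd h1 hv
    · exact absurd rfl hw'
  -- Subtracting the boundary of `y₁` pushes the cycle off all apexes: each `f' v` is replaced by
  -- the cone from `p v` over its boundary, which avoids `v`.
  let y₁ : Finset V → M := ∑ v ∈ D, cone (p v) (f' v)
  let z : Finset V → M := f - simplexBoundary y₁
  have hz0 : simplexBoundary z = 0 := by
    simp only [z, map_sub, hbf, simplexBoundary_simplexBoundary, sub_zero]
  have hz : z = (f - ∑ v ∈ D, f' v) + ∑ v ∈ D, cone (p v) (simplexBoundary (f' v)) := by
    simp only [z, y₁, map_sum, simplexBoundary_cone, Finset.sum_sub_distrib]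
    abel
  have hzs : ∀ σ, z σ ≠ 0 → (σ ∈ P ∧ σ.card = r + 1) ∧ Disjoint σ D := by
    intro σ h
    rw [hz, Pi.add_apply] at h
    by_cases h1 : (f - ∑ v ∈ D, f' v) σ = 0
    · rw [h1, zero_add, Finset.sum_apply] at h
      obtain ⟨v, hv, h⟩ := Finset.exists_ne_zero_of_sum_ne_zero h
      obtain ⟨τ, hpτ, rfl, hτ⟩ := cone_ne_zero h
      obtain ⟨hvτ, hτ'⟩ := hf' v τ hτ
      obtain ⟨hP1, hc⟩ := hf _ hτ'
      have hp1 := hp v hv _ hP1 (Finset.mem_insert_self v τ)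
      rw [Finset.card_insert_of_notMem hvτ] at hc
      refine ⟨⟨hP ?_ hp1.1, ?_⟩, ?_⟩
      · exact Finset.insert_subset_insert _ (Finset.subset_insert v τ)
      · rw [Finset.card_insert_of_notMem hpτ, hc]
      · rw [Finset.disjoint_left]
        intro w hw hwD
        rcases Finset.mem_insert.1 hw with rfl | hw
        · exact hp1.2 hwD
        · have := hD _ hP1 v hv w hwD (by simp) (by simp [hw])
          exact hvτ (this ▸ hw)
    · have hfσ : f σ ≠ 0 := by
        intro h0
        apply h1
        simp [f', h0]
      refine ⟨hf σ hfσ, ?_⟩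
      rw [Finset.disjoint_left]
      intro w hw hwD
      apply h1
      rw [Pi.sub_apply, Finset.sum_apply, Finset.sum_eq_single w]
      · simp [f', hw]
      · intro v hv hvw
        simp only [f']
        rw [if_neg]
        exact fun h => hvw (hD σ (hf σ hfσ).1 v hv w hwD h hw)
      · exact fun h => absurd hwD h
  -- The remaining cycle `z` avoids `D`, so the cone from `g` over it stays in `P` and fills it.
  refine ⟨y₁ + cone g z, fun σ h => ?_, ?_⟩
  · by_cases h1 : y₁ σ = 0
    · rw [Pi.add_apply, h1, zero_add] at h
      obtain ⟨τ, hgτ, rfl, hτ⟩ := cone_ne_zero h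
      obtain ⟨⟨h2, h3⟩, h4⟩ := hzs τ hτ
      exact ⟨hg τ h2 h4, by rw [Finset.card_insert_of_notMem hgτ, h3]⟩
    · simp only [y₁, Finset.sum_apply] at h1
      obtain ⟨v, hv, h⟩ := Finset.exists_ne_zero_of_sum_ne_zero h1
      obtain ⟨τ, hpτ, rfl, hτ⟩ := cone_ne_zero h
      simp only [f'] at hτ
      split_ifs at hτ with hvτ
      · obtain ⟨h2, h3⟩ := hf τ hτ
        exact ⟨(hp v hv τ h2 hvτ).1, by rw [Finset.card_insert_of_notMem hpτ, h3]⟩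
      · exact absurd rfl hτ
  · rw [map_add, simplexBoundary_cone, hz0]
    ext σ
    simp [z, cone]

end Simplex

/-! ### From labeled complexes to simplicial chains in each multidegree -/

section Transfer

variable {V : Type*} [LinearOrder V] {k : Type*} [Field k] {n : ℕ}

theorem mono_add (a b : Fin n →₀ ℕ) : mono k (a + b) = mono k a * mono k b := by
  simp [mono, MvPolynomial.monomial_mul]

theorem mono_ne_zero (a : Fin n →₀ ℕ) : mono k a ≠ 0 := by
  simp [mono]

theorem mem_span_mono_iff {A : Set (Fin n →₀ ℕ)} {x : MvPolynomial (Fin n) k} :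
    x ∈ Ideal.span (mono k '' A) ↔ ∀ b ∈ x.support, ∃ a ∈ A, a ≤ b :=
  MvPolynomial.mem_ideal_span_monomial_image

theorem mono_mem_span_mono_iff {A : Set (Fin n →₀ ℕ)} {b : Fin n →₀ ℕ} :
    mono k b ∈ Ideal.span (mono k '' A) ↔ ∃ a ∈ A, a ≤ b := by
  classical
  rw [mem_span_mono_iff, mono, MvPolynomial.support_monomial, if_neg one_ne_zero]
  simp

theorem mono_dvd_iff {a : Fin n →₀ ℕ} {x : MvPolynomial (Fin n) k} :
    mono k a ∣ x ↔ ∀ b, MvPolynomial.coeff b x ≠ 0 → a ≤ b := by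
  rw [← Ideal.mem_span_singleton, ← Set.image_singleton, mem_span_mono_iff]
  simp [MvPolynomial.mem_support_iff]

variable (k) (Δ : PreAbstractSimplicialComplex V) (label : V → (Fin n →₀ ℕ))

/-- The dehomogenization of a chain: a face `σ` is sent to its label times the face `σ` of the
full simplex. -/
noncomputable def dehomogenize (d : ℕ) : Chain k n Δ d →ₗ[MvPolynomial (Fin n) k]
    (Finset V → MvPolynomial (Fin n) k) :=
  Finsupp.linearCombination (MvPolynomial (Fin n) k) fun σ : Face Δ d =>
    Pi.single σ.1 (mono k (faceLabel label σ.1))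

variable {k Δ label}

theorem dehomogenize_single {d : ℕ} (σ : Face Δ d) (a : MvPolynomial (Fin n) k) :
    dehomogenize k Δ label d (Finsupp.single σ a) =
      Pi.single σ.1 (a * mono k (faceLabel label σ.1)) := by
  rw [dehomogenize, Finsupp.linearCombination_single, ← Pi.single_smul, smul_eq_mul]

theorem dehomogenize_apply {d : ℕ} (c : Chain k n Δ d) (σ : Face Δ d) :
    dehomogenize k Δ label d c σ.1 = c σ * mono k (faceLabel label σ.1) := by
  classical
  induction c using Finsupp.induction_linear with
  | zero => simp
  | add x y hx hy => simp [hx, hy, add_mul]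
  | single τ a =>
    rw [dehomogenize_single]
    by_cases h : τ = σ
    · subst h; simp
    · rw [Finsupp.single_eq_of_ne (Ne.symm h), zero_mul, Pi.single_eq_of_ne]
      exact fun h' => h (Subtype.ext h'.symm)

theorem dehomogenize_apply_of_not {d : ℕ} (c : Chain k n Δ d) {σ : Finset V}
    (h : ¬ (σ ∈ Δ.faces ∧ σ.card = d + 1)) : dehomogenize k Δ label d c σ = 0 := by
  induction c using Finsupp.induction_linear with
  | zero => simp
  | add x y hx hy => simp [hx, hy]
  | single τ a =>
    rw [dehomogenize_single, Pi.single_eq_of_ne]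
    rintro rfl
    exact h τ.2

theorem dehomogenize_injective (d : ℕ) : Function.Injective (dehomogenize k Δ label d) := by
  intro c c' h
  ext1 σ
  have := congrFun h σ.1
  rw [dehomogenize_apply, dehomogenize_apply] at this
  exact mul_right_cancel₀ (mono_ne_zero _) this

theorem coeff_dehomogenize_ne_zero {d : ℕ} {c : Chain k n Δ d} {σ : Finset V} {b : Fin n →₀ ℕ}
    (h : MvPolynomial.coeff b (dehomogenize k Δ label d c σ) ≠ 0) :
    (σ ∈ Δ.faces ∧ σ.card = d + 1) ∧ faceLabel label σ ≤ b := by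
  have hσ : σ ∈ Δ.faces ∧ σ.card = d + 1 := by
    by_contra h'
    exact h (by rw [dehomogenize_apply_of_not c h', MvPolynomial.coeff_zero])
  refine ⟨hσ, mono_dvd_iff.1 (Dvd.intro_left (c ⟨σ, hσ⟩) ?_) b h⟩
  exact (dehomogenize_apply c ⟨σ, hσ⟩).symm

variable [Fintype V]

/-- With `coeff_dehomogenize_ne_zero` this determines the image of dehomogenization: each
coefficient must be divisible by the label of its face, which can be tested monomial by monomial. -/
theorem exists_dehomogenize_eq {d : ℕ} {f : Finset V → MvPolynomial (Fin n) k}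
    (hf : ∀ σ b, MvPolynomial.coeff b (f σ) ≠ 0 →
      (σ ∈ Δ.faces ∧ σ.card = d + 1) ∧ faceLabel label σ ≤ b) :
    ∃ c, dehomogenize k Δ label d c = f := by
  have : Finite (Face Δ d) := inferInstanceAs (Finite {σ : Finset V // _})
  have hdvd : ∀ σ : Face Δ d, ∃ a, f σ.1 = mono k (faceLabel label σ.1) * a :=
    fun σ => mono_dvd_iff.2 fun b hb => (hf σ.1 b hb).2
  choose a ha using hdvd
  refine ⟨Finsupp.equivFunOnFinite.symm a, ?_⟩
  ext1 σ
  by_cases h : σ ∈ Δ.faces ∧ σ.card = d + 1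
  · rw [dehomogenize_apply _ ⟨σ, h⟩, ha ⟨σ, h⟩, mul_comm]
    rfl
  · rw [dehomogenize_apply_of_not _ h]
    ext b
    by_contra h'
    rw [MvPolynomial.coeff_zero] at h'
    exact h (hf σ b (Ne.symm h')).1

/-- The factor `lcm(σ) / lcm(σ ∖ {v})` is exactly what the change of label from `σ ∖ {v}` to `σ`
absorbs; only the sign remains. -/
theorem dehomogenize_boundary (d : ℕ) (c : Chain k n Δ (d + 1)) :
    dehomogenize k Δ label d (boundary k Δ label d c) =
      simplexBoundary (dehomogenize k Δ label (d + 1) c) := by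
  induction c using Finsupp.induction_linear with
  | zero => simp
  | add x y hx hy => simp only [map_add, hx, hy]
  | single σ a =>
    rw [dehomogenize_single, simplexBoundary_single, boundary, Finsupp.linearCombination_single,
      map_smul, map_sum, Finset.smul_sum]
    refine Finset.sum_congr rfl fun v _ => ?_
    rw [dehomogenize_single, ← Pi.single_smul]
    have hle : faceLabel label (σ.1.erase v.1) ≤ faceLabel label σ.1 :=
      Finset.sup_mono (Finset.erase_subset _ _)
    have hm : mono k (faceLabel label σ.1 - faceLabel label (σ.1.erase v.1)) *
        mono k (faceLabel label (σ.1.erase v.1)) = mono k (faceLabel label σ.1) := by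
      rw [← mono_add, tsub_add_cancel_of_le hle]
    congr 1
    rw [boundaryCoeff, Face.delete, mul_assoc, hm, posSign, zsmul_eq_mul, smul_eq_mul]
    push_cast
    ring

/-- The augmentation becomes the boundary map onto the empty face, so exactness at `C₀` is an
instance of the same acyclicity. -/
theorem simplexBoundary_dehomogenize_zero (c : Chain k n Δ 0) :
    simplexBoundary (dehomogenize k Δ label 0 c) = Pi.single ∅ (augmentation k Δ label c) := by
  induction c using Finsupp.induction_linear with
  | zero => simp
  | add x y hx hy => rw [map_add, map_add, map_add, hx, hy, Pi.single_add]
  | single σ a =>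
    obtain ⟨v, hv⟩ := Finset.card_eq_one.1 σ.2.2
    rw [dehomogenize_single, simplexBoundary_single, augmentation,
      Finsupp.linearCombination_single,
      Finset.sum_coe_sort σ.1 fun v =>
        (Pi.single (σ.1.erase v) (posSign σ.1 v • (a * mono k (faceLabel label σ.1))) :
          Finset V → MvPolynomial (Fin n) k), hv]
    simp [posSign, Finset.filter_singleton]

/-- Bayer and Sturmfels: a labeled complex whose subcomplexes of faces with label dividing a
given monomial are acyclic gives exact sequences in each multidegree. -/
theorem exists_simplexBoundary_eq
    (hac : ∀ b : Fin n →₀ ℕ, IsAcyclicFamily k {σ | (σ = ∅ ∨ σ ∈ Δ.faces) ∧ faceLabel label σ ≤ b})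
    (d : ℕ) (c : Chain k n Δ d) (hc : simplexBoundary (dehomogenize k Δ label d c) = 0) :
    ∃ c', boundary k Δ label d c' = c := by
  classical
  set x := dehomogenize k Δ label d c with hx
  have hb : ∀ b : Fin n →₀ ℕ, ∃ y : Finset V → k,
      (∀ σ, y σ ≠ 0 → (σ ∈ Δ.faces ∧ σ.card = d + 2) ∧ faceLabel label σ ≤ b) ∧
      simplexBoundary y = fun σ => MvPolynomial.coeff b (x σ) := by
    intro b
    obtain ⟨y, hy, hy'⟩ := hac b d (fun σ => MvPolynomial.coeff b (x σ))
      (fun σ h => by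
        obtain ⟨⟨h1, h2⟩, h3⟩ := coeff_dehomogenize_ne_zero h
        exact ⟨⟨Or.inr h1, h3⟩, h2⟩)
      (by
        ext τ
        have := simplexBoundary_comp (MvPolynomial.coeffAddMonoidHom b) x τ
        rw [hc] at this
        simpa using this)
    refine ⟨y, fun σ h => ?_, hy'⟩
    obtain ⟨⟨h1 | h1, h2⟩, h3⟩ := hy σ h
    · simp [h1] at h3
    · exact ⟨⟨h1, h3⟩, h2⟩
  choose y hy hy' using hb
  -- Only finitely many multidegrees occur in `x`; the fillings found in each of them are
  -- reassembled into one polynomial chain.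
  let B : Finset (Fin n →₀ ℕ) := Finset.univ.biUnion fun σ => (x σ).support
  let Y : Finset V → MvPolynomial (Fin n) k :=
    ∑ b ∈ B, fun σ => MvPolynomial.monomial b (y b σ)
  have hY : simplexBoundary Y = x := by
    ext1 τ
    have hterm : ∀ b, simplexBoundary (fun σ => MvPolynomial.monomial b (y b σ)) τ =
        MvPolynomial.monomial b (MvPolynomial.coeff b (x τ)) := fun b => by
      rw [← congrFun (hy' b) τ]
      exact simplexBoundary_comp (MvPolynomial.monomial (R := k) b).toAddMonoidHom (y b) τ
    rw [map_sum, Finset.sum_apply, Finset.sum_congr rfl fun b _ => hterm b]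
    conv_rhs => rw [MvPolynomial.as_sum (x τ)]
    refine (Finset.sum_subset ?_ ?_).symm
    · exact fun b hb => Finset.mem_biUnion.2 ⟨τ, Finset.mem_univ _, hb⟩
    · intro b _ hb
      rw [MvPolynomial.notMem_support_iff.1 hb, MvPolynomial.monomial_zero]
  obtain ⟨c', hc'⟩ := exists_dehomogenize_eq (k := k) (Δ := Δ) (label := label) (d := d + 1) (f := Y)
    (by
      intro σ b h
      refine hy b σ fun h0 => h ?_
      simp only [Y, Finset.sum_apply, MvPolynomial.coeff_sum, MvPolynomial.coeff_monomial]
      refine Finset.sum_eq_zero fun b' _ => ?_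
      split_ifs with hbb
      · rw [hbb, h0]
      · rfl)
  refine ⟨c', dehomogenize_injective (label := label) d ?_⟩
  rw [dehomogenize_boundary, hc', hY]

theorem exact_boundary_augmentation
    (hac : ∀ b : Fin n →₀ ℕ,
      IsAcyclicFamily k {σ | (σ = ∅ ∨ σ ∈ Δ.faces) ∧ faceLabel label σ ≤ b}) :
    Function.Exact (boundary k Δ label 0) (augmentation k Δ label) := by
  intro c
  have h := simplexBoundary_dehomogenize_zero (label := label) c
  constructor
  · intro hc
    rw [hc, Pi.single_zero] at h
    exact exists_simplexBoundary_eq hac 0 c h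
  · rintro ⟨c', rfl⟩
    rw [dehomogenize_boundary, simplexBoundary_simplexBoundary] at h
    simpa using (congrFun h ∅).symm

theorem exact_boundary_boundary
    (hac : ∀ b : Fin n →₀ ℕ,
      IsAcyclicFamily k {σ | (σ = ∅ ∨ σ ∈ Δ.faces) ∧ faceLabel label σ ≤ b}) (d : ℕ) :
    Function.Exact (boundary k Δ label (d + 1)) (boundary k Δ label d) := by
  intro c
  constructor
  · intro hc
    refine exists_simplexBoundary_eq hac (d + 1) c ?_
    rw [← dehomogenize_boundary, hc, map_zero]
  · rintro ⟨c', rfl⟩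
    apply dehomogenize_injective (label := label) d
    rw [dehomogenize_boundary, dehomogenize_boundary, simplexBoundary_simplexBoundary, map_zero]

end Transfer

theorem supportsFreeResolution_of_isAcyclicFamily {V : Type*} [LinearOrder V] [Fintype V]
    {k : Type*} [Field k] {n : ℕ} {Δ : PreAbstractSimplicialComplex V}
    {label : V → (Fin n →₀ ℕ)} {I : Ideal (MvPolynomial (Fin n) k)}
    (hI : IsMinimallyGeneratedBy I fun v : Vertex Δ => label v.1)
    (hac : ∀ b : Fin n →₀ ℕ,
      IsAcyclicFamily k {σ | (σ = ∅ ∨ σ ∈ Δ.faces) ∧ faceLabel label σ ≤ b}) :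
    SupportsFreeResolution Δ label I where
  minimallyGenerated := hI
  range_augmentation := by
    rw [augmentation, Finsupp.range_linearCombination, ← hI.span_eq]
    refine congrArg (Submodule.span _) (Set.ext fun x => ⟨?_, ?_⟩)
    · rintro ⟨σ, rfl⟩
      obtain ⟨v, hv⟩ := Finset.card_eq_one.1 σ.2.2
      refine ⟨⟨v, hv ▸ σ.2.1⟩, ?_⟩
      simp [hv, faceLabel]
    · rintro ⟨v, rfl⟩
      exact ⟨⟨{v.1}, v.2, by simp⟩, by simp [faceLabel]⟩
  exact_zero := exact_boundary_augmentation hac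
  exact_succ := exact_boundary_boundary hac

/-! ### Minimal generators of a square-free monomial ideal -/

section Generators

variable {k : Type*} [Field k] {n q : ℕ} {I : Ideal (MvPolynomial (Fin n) k)}
  {m : Fin q → (Fin n →₀ ℕ)}

theorem IsMinimallyGeneratedBy.eq_of_le (hm : IsMinimallyGeneratedBy I m) {i j : Fin q}
    (h : m i ≤ m j) : i = j := by
  by_contra hij
  refine hm.irredundant j ?_
  rw [← Set.image_image (mono k) m, mono_mem_span_mono_iff]
  exact ⟨m i, ⟨i, hij, rfl⟩, h⟩

/-- A square-free generator `a` divides `m i`, and some `m j` divides `a`. By minimality `j = i`, so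
`m i` divides `a`. -/
theorem IsMinimallyGeneratedBy.isSquareFreeMonomial (hm : IsMinimallyGeneratedBy I m)
    (hI : IsSquareFreeMonomialIdeal I) (i : Fin q) : IsSquareFreeMonomial (m i) := by
  obtain ⟨A, hA, rfl⟩ := hI
  have hmem : mono k (m i) ∈ Ideal.span (mono k '' A) := by
    rw [← hm.span_eq]
    exact Ideal.subset_span ⟨i, rfl⟩
  obtain ⟨a, ha, hai⟩ := mono_mem_span_mono_iff.1 hmem
  have hmem' : mono k a ∈ Ideal.span (mono k '' Set.range m) := by
    rw [← Set.range_comp]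
    exact hm.span_eq.symm ▸ Ideal.subset_span ⟨a, ha, rfl⟩
  obtain ⟨_, ⟨j, rfl⟩, hj⟩ := mono_mem_span_mono_iff.1 hmem'
  obtain rfl := hm.eq_of_le (hj.trans hai)
  exact fun x => (hj x).trans (hA a ha x)

end Generators

/-! ### Deleted vertices and minimal labels -/

section Vertices

variable {n q : ℕ} {m : Fin q → (Fin n →₀ ℕ)}

theorem L2label_ell (i j : Fin q) : L2label m (ell i j) = m i + m j := by
  rcases le_total i j with h | h <;> simp [L2label, ell, h, add_comm]

theorem exists_eq_ell (w : LVertex q) :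
    ell (ofLex w.1).1 (ofLex w.1).2 = w := by
  obtain ⟨w, hw⟩ := w
  simp [ell, hw]

theorem ell_eq_ell_iff {i j u v : Fin q} :
    ell i j = ell u v ↔ (i = u ∧ j = v) ∨ (i = v ∧ j = u) := by
  have h : ell i j = ell u v ↔ min i j = min u v ∧ max i j = max u v := by
    rw [Subtype.ext_iff, ell, ell, toLex_inj, Prod.mk_inj]
  rw [h]
  constructor
  · rintro ⟨h1, h2⟩
    grind
  · rintro (⟨rfl, rfl⟩ | ⟨rfl, rfl⟩)
    · simp
    · exact ⟨min_comm _ _, max_comm _ _⟩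

theorem ell_eq_ell_iff_pair {i j u v : Fin q} :
    ell i j = ell u v ↔ ({i, j} : Set (Fin q)) = {u, v} := by
  rw [ell_eq_ell_iff, Set.pair_eq_pair_iff]

theorem ell_isDiag_iff {i j : Fin q} : (ofLex (ell i j).1).1 = (ofLex (ell i j).1).2 ↔ i = j := by
  simp only [ell, ofLex_toLex]
  grind

/-- Two distinct vertices with equal labels share no index, since cancelling a common factor would
identify them. The minimum in the deletion rule is therefore strict, and comparing first indices
suffices. -/
theorem mem_deletedVertices_iff (hm : ∀ i j, m i ≤ m j → i = j) {w : LVertex q} :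
    w ∈ deletedVertices m ↔ ∃ w', L2label m w' < L2label m w ∨
      (L2label m w' = L2label m w ∧ (ofLex w.1).1 < (ofLex w'.1).1) := by
  constructor
  · rintro ⟨i, j, u, v, hne, hle, ⟨heq, ⟨hij, hiu, hiv⟩, rfl⟩ | ⟨hne', rfl⟩⟩
    · refine ⟨ell u v, Or.inr ⟨by rw [L2label_ell, L2label_ell, heq], ?_⟩⟩
      have hu : i ≠ u := by
        rintro rfl
        exact hne (by rw [hm j v (add_left_cancel heq).le])
      have hv : i ≠ v := by
        rintro rfl
        rw [add_comm (m u)] at heq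
        exact hne (by rw [hm j u (add_left_cancel heq).le, Set.pair_comm])
      simp only [ell, ofLex_toLex, min_eq_left hij]
      exact lt_min (lt_of_le_of_ne hiu hu) (lt_of_le_of_ne hiv hv)
    · exact ⟨ell i j, Or.inl (by rw [L2label_ell, L2label_ell]; exact lt_of_le_of_ne hle hne')⟩
  · rintro ⟨w', h⟩
    have hne : w' ≠ w := by
      rintro rfl
      rcases h with h | h
      · exact lt_irrefl _ h
      · exact lt_irrefl _ h.2
    have h1 := exists_eq_ell w
    have h2 := exists_eq_ell w'
    rcases h with h | ⟨h, hlt⟩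
    · refine ⟨_, _, _, _, ?_, h.le, Or.inr ⟨h.ne, h1.symm⟩⟩
      rw [Ne, ← ell_eq_ell_iff_pair, h1, h2]
      exact hne
    · refine ⟨_, _, _, _, ?_, h.ge, Or.inl ⟨h.symm, ⟨w.2, hlt.le, hlt.le.trans w'.2⟩, h1.symm⟩⟩
      rw [Ne, ← ell_eq_ell_iff_pair, h1, h2]
      exact hne.symm

theorem exists_notMem_deletedVertices (hm : ∀ i j, m i ≤ m j → i = j) (w : LVertex q) :
    ∃ w' ∉ deletedVertices m, L2label m w' ≤ L2label m w := by
  classical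
  -- Deletion of a vertex exhibits one with a label of smaller degree, or with the same label and a
  -- larger first index. Hence a minimum for this lexicographic order survives.
  obtain ⟨w', hw', hmin⟩ := Finset.exists_min_image
    (Finset.univ.filter fun w' : LVertex q => L2label m w' ≤ L2label m w)
    (fun w' => toLex ((L2label m w').degree, OrderDual.toDual (ofLex w'.1).1)) ⟨w, by simp⟩
  simp only [Finset.mem_filter, Finset.mem_univ, true_and] at hw' hmin
  refine ⟨w', fun hdel => ?_, hw'⟩
  obtain ⟨w'', h⟩ := (mem_deletedVertices_iff hm).1 hdel
  have hle : L2label m w'' ≤ L2label m w' := h.elim le_of_lt fun h => h.1.le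
  refine (hmin w'' (hle.trans hw')).not_gt ?_
  rw [Prod.Lex.toLex_lt_toLex]
  rcases h with h | h
  · left
    obtain ⟨c, hc⟩ := exists_add_of_le hle
    have hc0 : c ≠ 0 := by
      rintro rfl
      exact h.ne' (by simpa using hc)
    simp only [hc, map_add]
    have : c.degree ≠ 0 := by rwa [Ne, Finsupp.degree_eq_zero_iff]
    omega
  · exact Or.inr ⟨by simp only [h.1], h.2⟩

/-! ### Neighbours of square vertices -/

/-- Where `m i` has exponent one, `b` is at least two, which bounds any sum of two square-free
exponents. Only the variables outside `m i` need checking. -/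
theorem add_le_of_add_self_le (hsq : ∀ i, IsSquareFreeMonomial (m i)) {b : Fin n →₀ ℕ}
    {i u : Fin q} (hi : m i + m i ≤ b) (hu : ∀ x, m i x = 0 → m u x ≤ b x) : m i + m u ≤ b := by
  intro x
  have h1 := hi x
  have h2 := hsq i x
  have h3 := hsq u x
  have h4 := hu x
  simp only [Finsupp.add_apply] at h1 ⊢
  omega

/-- A square vertex that is not alone below `b` has a neighbour below `b` that is not deleted. -/
theorem exists_ell_notMem_deletedVertices (hm : ∀ i j, m i ≤ m j → i = j)
    (hsq : ∀ i, IsSquareFreeMonomial (m i)) {b : Fin n →₀ ℕ} {i : Fin q} (hi : m i + m i ≤ b)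
    {w : LVertex q} (hw : w ≠ ell i i) (hwb : L2label m w ≤ b) :
    ∃ j, i ≠ j ∧ ell i j ∉ deletedVertices m ∧ m i + m j ≤ b := by
  classical
  let J : Finset (Fin q) := Finset.univ.filter fun j => i ≠ j ∧ m i + m j ≤ b
  -- Since `w` is not `ell i i`, one of its two indices differs from `i`, and that index lies in
  -- `J`.
  have hJ : J.Nonempty := by
    rw [← exists_eq_ell w] at hw hwb
    set u := (ofLex w.1).1
    set v := (ofLex w.1).2
    rw [L2label_ell] at hwb
    by_cases hu : i = u
    · have hv : i ≠ v := fun hv => hw (by rw [← hu, ← hv])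
      refine ⟨v, Finset.mem_filter.2 ⟨Finset.mem_univ _, hv, ?_⟩⟩
      exact add_le_of_add_self_le hsq hi fun x _ => (Nat.le_add_left _ _).trans (hwb x)
    · refine ⟨u, Finset.mem_filter.2 ⟨Finset.mem_univ _, hu, ?_⟩⟩
      exact add_le_of_add_self_le hsq hi fun x _ => (Nat.le_add_right _ _).trans (hwb x)
  -- Truncated subtraction makes `m j - m i` the part of `m j` outside `m i`. If `ell i j` were
  -- deleted because of `ell u v`, then `u` would contradict minimality.
  obtain ⟨j, hj, hmin⟩ := Finset.exists_min_image J (fun j => (m j - m i).degree) hJ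
  obtain ⟨-, hij, hjb⟩ := Finset.mem_filter.1 hj
  refine ⟨j, hij, fun hdel => ?_, hjb⟩
  obtain ⟨w', h⟩ := (mem_deletedVertices_iff hm).1 hdel
  have hne : w' ≠ ell i j := by
    rintro rfl
    rcases h with h | h
    · exact lt_irrefl _ h
    · exact lt_irrefl _ h.2
  have hle : L2label m w' ≤ L2label m (ell i j) := h.elim le_of_lt fun h => h.1.le
  rw [← exists_eq_ell w'] at hne hle
  set u := (ofLex w'.1).1
  set v := (ofLex w'.1).2
  rw [L2label_ell, L2label_ell] at hle
  have hu : i ≠ u := by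
    intro hu
    rw [← hu] at hle hne
    exact hne (by rw [hm v j (le_of_add_le_add_left hle)])
  have hv : i ≠ v := by
    intro hv
    rw [← hv, add_comm] at hle
    rw [← hv, hm u j (le_of_add_le_add_left hle)] at hne
    exact hne (ell_eq_ell_iff.2 (Or.inr ⟨rfl, rfl⟩))
  have huJ : u ∈ J := by
    refine Finset.mem_filter.2 ⟨Finset.mem_univ _, hu, ?_⟩
    exact add_le_of_add_self_le hsq hi fun x _ =>
      (Nat.le_add_right _ _).trans ((hle x).trans (hjb x))
  -- At a variable of `m i` all truncated differences vanish by square-freeness; elsewhere this is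
  -- the divisibility `hle`.
  have hsum : (m u - m i) + (m v - m i) ≤ m j - m i := by
    intro x
    have h1 := hle x
    have h2 := hsq i x
    have h3 := hsq u x
    have h4 := hsq v x
    simp only [Finsupp.add_apply, Finsupp.tsub_apply] at h1 ⊢
    omega
  -- `m v` does not divide `m i`, so the degree of `m u - m i` is strictly smaller than that of `m j
  -- - m i`.
  have hv0 : (m v - m i).degree ≠ 0 := by
    rw [Ne, Finsupp.degree_eq_zero_iff, tsub_eq_zero_iff_le]
    exact fun h => hv (hm v i h).symm
  have h1 := hmin u huJ
  have h2 := Finsupp.degree_mono hsum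
  rw [map_add] at h2
  omega

/-! ### Faces of 𝕃²(I), generators of I² and acyclicity -/

theorem mem_L2_faces_iff {σ : Finset (LVertex q)} : (σ = ∅ ∨ σ ∈ (L2 m).faces) ↔
    (∀ w ∈ σ, w ∉ deletedVertices m) ∧ ((∃ i, ∀ w ∈ σ, ∃ j, ell i j = w) ∨
      ∀ w ∈ σ, (ofLex w.1).1 ≠ (ofLex w.1).2) := by
  rcases σ.eq_empty_or_nonempty with rfl | hne
  · simp
  have h0 : (∀ w ∈ σ, (ofLex w.1).1 ≠ (ofLex w.1).2) ↔
      σ ⊆ (Finset.univ.filter fun p : Fin q × Fin q => p.1 < p.2).image fun p => ell p.1 p.2 := by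
    constructor
    · intro h w hw
      rw [Finset.mem_image]
      exact ⟨ofLex w.1, by simpa using lt_of_le_of_ne w.2 (h w hw), exists_eq_ell w⟩
    · intro h w hw
      obtain ⟨p, hp, rfl⟩ := Finset.mem_image.1 (h hw)
      rw [Ne, ell_isDiag_iff]
      exact (Finset.mem_filter.1 hp).2.ne
  have h1 : ∀ i : Fin q, (∀ w ∈ σ, ∃ j, ell i j = w) ↔
      σ ⊆ Finset.univ.image fun j => ell i j := by
    intro i
    simp [Finset.subset_iff]
  simp only [hne.ne_empty, false_or, h0, h1]
  constructor
  · rintro ⟨⟨-, F, ⟨i, rfl⟩ | hF, hσ⟩, hdel⟩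
    · exact ⟨hdel, Or.inl ⟨i, hσ⟩⟩
    · rw [Set.mem_singleton_iff] at hF
      exact ⟨hdel, Or.inr (hF ▸ hσ)⟩
  · rintro ⟨hdel, ⟨i, hσ⟩ | hσ⟩
    · exact ⟨⟨hne, _, Or.inl ⟨i, rfl⟩, hσ⟩, hdel⟩
    · exact ⟨⟨hne, _, Or.inr rfl, hσ⟩, hdel⟩

theorem singleton_mem_L2_faces_iff {w : LVertex q} :
    {w} ∈ (L2 m).faces ↔ w ∉ deletedVertices m := by
  have h := mem_L2_faces_iff (m := m) (σ := {w})
  rw [or_iff_right (Finset.singleton_ne_empty w)] at h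
  rw [h]
  simp only [Finset.mem_singleton, forall_eq, and_iff_left_iff_imp]
  exact fun _ => Or.inl ⟨_, _, exists_eq_ell w⟩

theorem isMinimallyGeneratedBy_L2 {k : Type*} [Field k] {I : Ideal (MvPolynomial (Fin n) k)}
    (hI : IsMinimallyGeneratedBy I m) :
    IsMinimallyGeneratedBy (I ^ 2) fun v : Vertex (L2 m) => L2label m v.1 where
  span_eq := by
    have hm : ∀ i j, m i ≤ m j → i = j := fun _ _ => hI.eq_of_le
    rw [← hI.span_eq, pow_two, Ideal.span_mul_span']
    apply le_antisymm
    · rw [Ideal.span_le]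
      rintro _ ⟨v, rfl⟩
      refine Ideal.subset_span ⟨_, ⟨(ofLex v.1.1).1, rfl⟩, _, ⟨(ofLex v.1.1).2, rfl⟩, ?_⟩
      exact (mono_add _ _).symm
    · rw [Ideal.span_le]
      rintro _ ⟨_, ⟨i, rfl⟩, _, ⟨j, rfl⟩, rfl⟩
      obtain ⟨w, hw, hle⟩ := exists_notMem_deletedVertices hm (ell i j)
      rw [L2label_ell] at hle
      have hr : (Set.range fun v : Vertex (L2 m) => mono k (L2label m v.1)) =
          mono k '' Set.range fun v : Vertex (L2 m) => L2label m v.1 :=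
        Set.range_comp (mono k) fun v : Vertex (L2 m) => L2label m v.1
      simp only [SetLike.mem_coe, ← mono_add, hr, mono_mem_span_mono_iff]
      exact ⟨_, ⟨⟨w, singleton_mem_L2_faces_iff.2 hw⟩, rfl⟩, hle⟩
  irredundant := by
    have hm : ∀ i j, m i ≤ m j → i = j := fun _ _ => hI.eq_of_le
    intro v hv
    rw [← Set.image_image (mono k) fun v : Vertex (L2 m) => L2label m v.1,
      mono_mem_span_mono_iff] at hv
    obtain ⟨_, ⟨w, hne, rfl⟩, hle⟩ := hv
    have hvd := singleton_mem_L2_faces_iff.1 v.2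
    have hwd := singleton_mem_L2_faces_iff.1 w.2
    rw [mem_deletedVertices_iff hm] at hvd hwd
    push Not at hvd hwd
    rcases hle.lt_or_eq with h | h
    · exact (hvd w.1).1 h
    -- Both vertices survive, so neither first index exceeds the other; cancellation then gives
    -- equal second indices.
    · have hfst : (ofLex v.1.1).1 = (ofLex w.1.1).1 :=
        le_antisymm ((hwd v.1).2 h.symm) ((hvd w.1).2 h)
      simp only [L2label, hfst] at h
      have hsnd := hm _ _ (add_left_cancel h).le
      refine hne (Subtype.ext ?_)
      rw [← exists_eq_ell w.1, ← exists_eq_ell v.1, hfst, hsnd]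

theorem isAcyclicFamily_L2 (M : Type*) [AddCommGroup M] (hm : ∀ i j, m i ≤ m j → i = j)
    (hsq : ∀ i, IsSquareFreeMonomial (m i)) (b : Fin n →₀ ℕ) :
    IsAcyclicFamily M
      {σ | (σ = ∅ ∨ σ ∈ (L2 m).faces) ∧ faceLabel (L2label m) σ ≤ b} := by
  classical
  let W : Set (LVertex q) := {w | w ∉ deletedVertices m ∧ L2label m w ≤ b}
  have hset : {σ | (σ = ∅ ∨ σ ∈ (L2 m).faces) ∧ faceLabel (L2label m) σ ≤ b} =
      {σ : Finset (LVertex q) | (∀ w ∈ σ, w ∈ W) ∧ ((∃ i, ∀ w ∈ σ, ∃ j, ell i j = w) ∨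
        ∀ w ∈ σ, (ofLex w.1).1 ≠ (ofLex w.1).2)} := by
    ext σ
    rw [Set.mem_ofPred_eq, Set.mem_ofPred_eq, mem_L2_faces_iff, faceLabel, Finset.sup_le_iff]
    simp only [W, Set.mem_ofPred_eq, forall₂_and]
    tauto
  rw [hset]
  have hlow : IsLowerSet {σ : Finset (LVertex q) | (∀ w ∈ σ, w ∈ W) ∧
      ((∃ i, ∀ w ∈ σ, ∃ j, ell i j = w) ∨ ∀ w ∈ σ, (ofLex w.1).1 ≠ (ofLex w.1).2)} := by
    rintro σ τ hτ ⟨h1, h2⟩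
    exact ⟨fun w hw => h1 w (hτ hw), h2.imp (fun ⟨i, h⟩ => ⟨i, fun w hw => h w (hτ hw)⟩)
      fun h w hw => h w (hτ hw)⟩
  -- This provides a vertex of the face over which the square vertex `v` is a cone.
  have hnbr : ∀ v ∈ W, (ofLex v.1).1 = (ofLex v.1).2 → ∀ w ∈ W, w ≠ v →
      ∃ j, (ofLex v.1).1 ≠ j ∧ ell (ofLex v.1).1 j ∈ W := by
    intro v hv hvd w hw hwv
    have hvl := hv.2
    rw [L2label, ← hvd] at hvl
    rw [← exists_eq_ell v, ← hvd] at hwv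
    obtain ⟨j, h1, h2, h3⟩ := exists_ell_notMem_deletedVertices hm hsq hvl hwv hw.2
    exact ⟨j, h1, h2, by rwa [L2label_ell]⟩
  by_cases hg : ∃ g ∈ W, (ofLex g.1).1 ≠ (ofLex g.1).2
  · obtain ⟨g, hgW, hgd⟩ := hg
    have hp : ∀ v : LVertex q, ∃ j, v ∈ W ∧ (ofLex v.1).1 = (ofLex v.1).2 →
        (ofLex v.1).1 ≠ j ∧ ell (ofLex v.1).1 j ∈ W := by
      intro v
      by_cases hv : v ∈ W ∧ (ofLex v.1).1 = (ofLex v.1).2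
      · obtain ⟨j, hj⟩ := hnbr v hv.1 hv.2 g hgW (fun h => hgd (h ▸ hv.2))
        exact ⟨j, fun _ => hj⟩
      -- A default value: only square vertices in `W` serve as apexes.
      · exact ⟨(ofLex v.1).1, fun h => absurd h hv⟩
    choose p hp using hp
    have hstar : ∀ {i : Fin q} {σ : Finset (LVertex q)} {v : LVertex q},
        (∀ w ∈ σ, ∃ j, ell i j = w) → v ∈ σ → (ofLex v.1).1 = (ofLex v.1).2 →
        i = (ofLex v.1).1 := by
      intro i σ v h hv hvd
      obtain ⟨j, rfl⟩ := h v hv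
      obtain rfl := ell_isDiag_iff.1 hvd
      simp [ell]
    refine isAcyclicFamily_of_cones hlow
      (Finset.univ.filter fun v => v ∈ W ∧ (ofLex v.1).1 = (ofLex v.1).2) ?_
      (fun v => ell (ofLex v.1).1 (p v)) ?_ g ?_
    · rintro σ ⟨-, ⟨i, hi⟩ | hσ⟩ v hv w hw hvσ hwσ
      · have hvd := (Finset.mem_filter.1 hv).2.2
        have hwd := (Finset.mem_filter.1 hw).2.2
        rw [← exists_eq_ell v, ← exists_eq_ell w, ← hvd, ← hwd, ← hstar hi hvσ hvd,
          ← hstar hi hwσ hwd]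
      · exact absurd (Finset.mem_filter.1 hv).2.2 (hσ v hvσ)
    · rintro v hv σ ⟨hσW, hσ⟩ hvσ
      have hv' := (Finset.mem_filter.1 hv).2
      obtain ⟨h1, h2⟩ := hp v hv'
      refine ⟨⟨?_, Or.inl ⟨(ofLex v.1).1, ?_⟩⟩, ?_⟩
      · exact fun w hw => (Finset.mem_insert.1 hw).elim (fun h => h ▸ h2) (hσW w)
      · rcases hσ with ⟨i, hi⟩ | hσ
        · obtain rfl := hstar hi hvσ hv'.2
          exact fun w hw => (Finset.mem_insert.1 hw).elim (fun h => ⟨p v, h.symm⟩) (hi w)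
        · exact absurd hv'.2 (hσ v hvσ)
      · rw [Finset.mem_filter, ell_isDiag_iff]
        exact fun h => h1 h.2.2
    · rintro σ ⟨hσW, -⟩ hdisj
      refine ⟨fun w hw => (Finset.mem_insert.1 hw).elim (fun h => h ▸ hgW) (hσW w), Or.inr ?_⟩
      intro w hw
      rcases Finset.mem_insert.1 hw with rfl | hw
      · exact hgd
      · exact fun h => Finset.disjoint_left.1 hdisj hw
          (Finset.mem_filter.2 ⟨Finset.mem_univ _, hσW w hw, h⟩)
  -- With only square vertices in `W`, `hnbr` forbids two of them, so the complex is a point or has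
  -- no vertices.
  · push Not at hg
    by_cases hne : ∃ g, g ∈ W
    · obtain ⟨g, hgW⟩ := hne
      have huniq : ∀ w ∈ W, w = g := by
        intro w hw
        by_contra hwg
        obtain ⟨j, h1, h2⟩ := hnbr g hgW (hg g hgW) w hw hwg
        exact h1 (ell_isDiag_iff.1 (hg _ h2))
      refine isAcyclicFamily_of_cones hlow ∅ (by simp) id (by simp) g ?_
      rintro σ ⟨hσW, -⟩ -
      have hmem : ∀ w ∈ insert g σ, w = g := fun w hw =>
        (Finset.mem_insert.1 hw).elim id fun h => huniq w (hσW w h)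
      refine ⟨fun w hw => hmem w hw ▸ hgW, Or.inl ⟨(ofLex g.1).1, fun w hw => ?_⟩⟩
      exact ⟨(ofLex g.1).2, by rw [hmem w hw, exists_eq_ell]⟩
    · push Not at hne
      -- Without vertices the only face is empty, of cardinality `0 ≠ r + 1`, so `f` vanishes.
      intro r f hf _
      refine ⟨0, fun σ h => absurd rfl h, ?_⟩
      rw [map_zero]
      ext σ
      by_contra h
      obtain ⟨⟨hσW, -⟩, hc⟩ := hf σ (Ne.symm h)
      obtain ⟨w, hw⟩ := Finset.card_pos.1 (by omega : 0 < σ.card)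
      exact hne w (hσW w hw)

end Vertices

end MonomialResolution

theorem theorem3p8 {k : Type*} [Field k] {n : ℕ} (I : Ideal (MvPolynomial (Fin n) k))
    (hI : MonomialResolution.IsSquareFreeMonomialIdeal I)
    {q : ℕ} (m : Fin q → (Fin n →₀ ℕ)) (hm : MonomialResolution.IsMinimallyGeneratedBy I m) :
    MonomialResolution.SupportsFreeResolution (MonomialResolution.L2 m)
      (MonomialResolution.L2label m) (I ^ 2) :=
  MonomialResolution.supportsFreeResolution_of_isAcyclicFamily
    (MonomialResolution.isMinimallyGeneratedBy_L2 hm) fun b =>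
      MonomialResolution.isAcyclicFamily_L2 k (fun _ _ => hm.eq_of_le)
        (hm.isSquareFreeMonomial hI) b
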